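/- Let $\sigma$ be a partition of the set of all primes. For a positive integer $n$ let $\sigma(n)$ be the set of those members of $\sigma$ that contain a prime divisor of $n$, and put $\sigma(G)=\sigma(|G|)$ for a finite group $G$. For a set $\pi$ of primes, a Hall $\pi$-subgroup of $G$ is a subgroup whose order has all its prime divisors in $\pi$ and whose index has no prime divisor in $\pi$; a $\pi$-subgroup is one whose order has all its prime divisors in $\pi$; and $G$ is a $D_\pi$-group if it has a Hall $\pi$-subgroup $E$ such that every $\pi$-subgroup of $G$ is contained in a conjugate of $E$. A finite group $G$ is called - a *$\sigma$-full group of Sylow type* if every subgroup $E$ of $G$ is a $D_{s}$-group for every $s\in\sigma(E)$; - *$\sigma$-primary* if $|\sigma(G)|\le 1$. A *complete Hall $\sigma$-set* of $G$ is a set $\mathcal H$ of subgroups of $G$ such that every member $\neq 1$ of $\mathcal H$ is a Hall $s$-subgroup of $G$ for some $s\in\sigma$, and $\mathcal H$ contains exactly one Hall $s$-subgroup of $G$ for every $s\in\sigma(G)$. A subgroup $A$ of $G$ is called - a *$\sigma$-Hall subgroup* if, for some $\Pi\subseteq\sigma$, $\sigma(|A|)\subseteq\Pi$ and $\sigma(|G:A|)\subseteq\sigma\setminus\Pi$;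 - *$\sigma$-permutable* in $G$ if $G$ has a complete Hall $\sigma$-set $\mathcal H$ such that $AH^x=H^xA$ for all $H\in\mathcal H$ and all $x\in G$; - *$\sigma$-subnormal* in $G$ if there is a chain of subgroups $A=A_0\le A_1\le\dots\le A_t=G$ such that, for each $i=1,\dots,t$, either $A_{i-1}$ is normal in $A_i$ or $A_i/(A_{i-1})_{A_i}$ is $\sigma$-primary, where $(A_{i-1})_{A_i}$ is the largest normal subgroup of $A_i$ contained in $A_{i-1}$. $G$ is a *$P\sigma T$-group* if $\sigma$-permutability is transitive in $G$: whenever $K\le H\le G$, $K$ is $\sigma$-permutable in $H$ and $H$ is $\sigma$-permutable in $G$, then $K$ is $\sigma$-permutable in $G$. **Theorem A.** Let $G$ be a finite group with a normal $\sigma$-Hall subgroup $D$ such that (i) $G/D$ is a $P\sigma T$-group, and (ii) every $\sigma$-subnormal subgroup of $D$ is normal in $G$. If $G$ is a $\sigma$-full group of Sylow type, then $G$ is a $P\sigma T$-group. -/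

import Mathlib

open scoped Pointwise

/-- `σ(n)`: the members of `σ` that contain a prime divisor of `n`. -/
def sigmaOf (σ : Set (Set Nat.Primes)) (n : ℕ) : Set (Set Nat.Primes) :=
  {s | s ∈ σ ∧ ∃ p ∈ s, (p : ℕ) ∣ n}

/-- `n` is a `π`-number, for a set `π` of primes. -/
def IsPiNumber (π : Set Nat.Primes) (n : ℕ) : Prop :=
  ∀ p : Nat.Primes, (p : ℕ) ∣ n → p ∈ π

/-- `A` is a Hall `π`-subgroup of `G`, for a set `π` of primes. -/
def IsHallPi {G : Type*} [Group G] (π : Set Nat.Primes) (A : Subgroup G) : Prop :=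
  IsPiNumber π (Nat.card A) ∧ IsPiNumber πᶜ A.index

/-- `A` is a Hall `P`-subgroup of `G`, for `P ⊆ σ`. -/
def IsHallSigmaPi {G : Type*} [Group G] (σ P : Set (Set Nat.Primes)) (A : Subgroup G) : Prop :=
  sigmaOf σ (Nat.card A) ⊆ P ∧ sigmaOf σ A.index ⊆ σ \ P

/-- `A` is a `σ`-Hall subgroup of `G`. -/
def IsSigmaHall {G : Type*} [Group G] (σ : Set (Set Nat.Primes)) (A : Subgroup G) : Prop :=
  ∃ P : Set (Set Nat.Primes), P ⊆ σ ∧ IsHallSigmaPi σ P A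

/-- The conjugate `H ^ x = x⁻¹ H x`. -/
def conjSubgroup {G : Type*} [Group G] (H : Subgroup G) (x : G) : Subgroup G :=
  H.map (MulAut.conj x⁻¹).toMonoidHom

/-- `G` is a `D_π`-group. -/
def IsDGroup (π : Set Nat.Primes) (G : Type*) [Group G] : Prop :=
  ∃ E : Subgroup G, IsHallPi π E ∧
    ∀ B : Subgroup G, IsPiNumber π (Nat.card B) → ∃ x : G, B ≤ conjSubgroup E x

/-- `G` is a `σ`-full group of Sylow type. -/
def IsSigmaFullOfSylowType (σ : Set (Set Nat.Primes)) (G : Type*) [Group G] : Prop :=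
  ∀ E : Subgroup G, ∀ s ∈ sigmaOf σ (Nat.card E), IsDGroup s E

/-- `G` is `σ`-primary: `|σ(G)| ≤ 1`. -/
def IsSigmaPrimary (σ : Set (Set Nat.Primes)) (G : Type*) [Group G] : Prop :=
  (sigmaOf σ (Nat.card G)).Subsingleton

/-- `ℋ` is a complete Hall `σ`-set of `G`. -/
def IsCompleteHallSet {G : Type*} [Group G] (σ : Set (Set Nat.Primes))
    (ℋ : Set (Subgroup G)) : Prop :=
  (∀ H ∈ ℋ, H ≠ ⊥ → ∃ s ∈ σ, IsHallPi s H) ∧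
    ∀ s ∈ sigmaOf σ (Nat.card G), ∃! H : Subgroup G, H ∈ ℋ ∧ IsHallPi s H

/-- `A` is `σ`-permutable (`σ`-quasinormal) in `G`. -/
def IsSigmaPermutable {G : Type*} [Group G] (σ : Set (Set Nat.Primes))
    (A : Subgroup G) : Prop :=
  ∃ ℋ : Set (Subgroup G), IsCompleteHallSet σ ℋ ∧
    ∀ H ∈ ℋ, ∀ x : G,
      (A : Set G) * (conjSubgroup H x : Set G) = (conjSubgroup H x : Set G) * (A : Set G)

/-- `A` is `σ`-subnormal in `G`. -/
def IsSigmaSubnormal {G : Type*} [Group G] (σ : Set (Set Nat.Primes))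
    (A : Subgroup G) : Prop :=
  ∃ (t : ℕ) (c : ℕ → Subgroup G), c 0 = A ∧ c t = ⊤ ∧
    ∀ i < t, c i ≤ c (i + 1) ∧
      (((c i).subgroupOf (c (i + 1))).Normal ∨
        IsSigmaPrimary σ (c (i + 1) ⧸ ((c i).subgroupOf (c (i + 1))).normalCore))

/-- `G` is a `PσT`-group: `σ`-permutability is a transitive relation in `G`. -/
def IsPSigmaTGroup (σ : Set (Set Nat.Primes)) (G : Type*) [Group G] : Prop :=
  ∀ H K : Subgroup G, K ≤ H → IsSigmaPermutable σ (K.subgroupOf H) →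
    IsSigmaPermutable σ H → IsSigmaPermutable σ K

/-! In a `σ`-full group of Sylow type the Hall `s`-subgroups are conjugate for each `s ∈ σ`, so
being `σ`-permutable means permuting with all of them. Such subgroups are `σ`-subnormal
(`PermutesWithHalls.sigmaSubnormalIn`). Hence if `K` is `σ`-permutable in `H` and `H` in `G`, then
`K` is `σ`-subnormal in `G`. So `K ⊓ D` is `σ`-subnormal in `D`, thus normal in `G` by (ii), and the
image of `K` in `G ⧸ D` is `σ`-subnormal, thus `σ`-permutable by (i).

To lift this to `G`, note that `K = (K ⊓ D)(K ⊓ C)` for every complement `C` of `D`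
(`exists_mul_of_isComplement'`). A Hall `s`-subgroup `T` either lies in `D`, which normalizes `K`,
or lies in some complement `C`. In the second case `C` maps isomorphically onto `G ⧸ D`, so the
permutability of the images lifts to `K ⊓ C` and `T`, while `K ⊓ D` is normal. -/

section

variable {G G' : Type*} [Group G] [Group G']

/-! ### Numbers whose prime divisors lie in a given set -/

theorem IsPiNumber.of_dvd {π : Set Nat.Primes} {m n : ℕ} (h : IsPiNumber π n) (hmn : m ∣ n) :
    IsPiNumber π m := fun p hp => h p (hp.trans hmn)

theorem IsPiNumber.mono {π ρ : Set Nat.Primes} {n : ℕ} (h : IsPiNumber π n) (hπ : π ⊆ ρ) :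
    IsPiNumber ρ n := fun p hp => hπ (h p hp)

theorem IsPiNumber.mul {π : Set Nat.Primes} {m n : ℕ} (hm : IsPiNumber π m)
    (hn : IsPiNumber π n) : IsPiNumber π (m * n) := fun p hp =>
  (p.2.dvd_mul.1 hp).elim (hm p) (hn p)

theorem IsPiNumber.eq_one {π : Set Nat.Primes} {n : ℕ} (h : IsPiNumber π n)
    (h' : IsPiNumber πᶜ n) : n = 1 := by
  by_contra hn
  obtain ⟨p, hp, hpn⟩ := Nat.exists_prime_and_dvd hn
  exact h' ⟨p, hp⟩ hpn (h ⟨p, hp⟩ hpn)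

theorem IsPiNumber.coprime {π : Set Nat.Primes} {m n : ℕ} (h : IsPiNumber π m)
    (h' : IsPiNumber πᶜ n) : m.Coprime n :=
  (h.of_dvd (Nat.gcd_dvd_left m n)).eq_one (h'.of_dvd (Nat.gcd_dvd_right m n))

theorem Setoid.IsPartition.subset_compl {α : Type*} {σ : Set (Set α)} (hσ : Setoid.IsPartition σ)
    {s t : Set α} (hs : s ∈ σ) (ht : t ∈ σ) (h : s ≠ t) : s ⊆ tᶜ :=
  Set.disjoint_left.1 (hσ.pairwiseDisjoint hs ht h)

theorem Setoid.IsPartition.subset_or_subset_compl_sUnion {α : Type*} {σ P : Set (Set α)}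
    (hσ : Setoid.IsPartition σ) (hP : P ⊆ σ) {s : Set α} (hs : s ∈ σ) :
    s ⊆ ⋃₀ P ∨ s ⊆ (⋃₀ P)ᶜ := by
  by_cases h : s ∈ P
  · exact Or.inl (Set.subset_sUnion_of_mem h)
  · refine Or.inr fun p hp hp' => ?_
    obtain ⟨t, ht, hpt⟩ := hp'
    exact hσ.subset_compl hs (hP ht) (fun e => h (e ▸ ht)) hp hpt

theorem IsHallSigmaPi.isHallPi {σ P : Set (Set Nat.Primes)} (hσ : Setoid.IsPartition σ)
    (hP : P ⊆ σ) {A : Subgroup G} (h : IsHallSigmaPi σ P A) : IsHallPi (⋃₀ P) A := by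
  refine ⟨fun p hp => ?_, fun p hp => ?_⟩ <;> obtain ⟨s, ⟨hs, hps⟩, hu⟩ := hσ.2 p
  · exact ⟨s, h.1 ⟨hs, p, hps, hp⟩, hps⟩
  · rintro ⟨t, ht, hpt⟩
    exact (h.2 ⟨hs, p, hps, hp⟩).2 (hu t ⟨hP ht, hpt⟩ ▸ ht)

/-! ### Permuting subgroups -/

/-- The subgroups `A` and `T` permute: `AT = TA`. -/
def Permutes (A T : Subgroup G) : Prop := (A : Set G) * (T : Set G) = (T : Set G) * (A : Set G)

theorem permutes_iff {A T : Subgroup G} :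
    Permutes A T ↔ ∀ a ∈ A, ∀ t ∈ T, ∃ t' ∈ T, ∃ a' ∈ A, a * t = t' * a' := by
  constructor
  · intro h a ha t ht
    have : a * t ∈ (T : Set G) * (A : Set G) := h ▸ Set.mul_mem_mul ha ht
    obtain ⟨t', ht', a', ha', e⟩ := this
    exact ⟨t', ht', a', ha', e.symm⟩
  · intro h
    apply subset_antisymm
    · rintro _ ⟨a, ha, t, ht, rfl⟩
      obtain ⟨t', ht', a', ha', e⟩ := h a ha t ht
      exact ⟨t', ht', a', ha', e.symm⟩
    · rintro _ ⟨t, ht, a, ha, rfl⟩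
      obtain ⟨t', ht', a', ha', e⟩ := h a⁻¹ (inv_mem ha) t⁻¹ (inv_mem ht)
      refine ⟨a'⁻¹, inv_mem ha', t'⁻¹, inv_mem ht', ?_⟩
      simpa using (congrArg (·⁻¹) e).symm

theorem Permutes.symm {A T : Subgroup G} (h : Permutes A T) : Permutes T A := Eq.symm h

/-- `B` normalizes `A`. -/
def Normalizes (B A : Subgroup G) : Prop := ∀ b ∈ B, ∀ a ∈ A, b * a * b⁻¹ ∈ A

theorem Normalizes.permutes {A T : Subgroup G} (h : Normalizes T A) : Permutes A T :=
  permutes_iff.2 fun a ha t ht =>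
    ⟨t, ht, t⁻¹ * a * t, by simpa using h t⁻¹ (inv_mem ht) a ha, by group⟩

theorem Permutes.mem_sup {A T : Subgroup G} (h : Permutes A T) {x : G} (hx : x ∈ A ⊔ T) :
    ∃ a ∈ A, ∃ t ∈ T, a * t = x := by
  rw [Subgroup.sup_eq_closure_mul] at hx
  induction hx using Subgroup.closure_induction with
  | mem x hx => exact hx
  | one => exact ⟨1, one_mem _, 1, one_mem _, one_mul 1⟩
  | mul x y _ _ hx hy =>
    obtain ⟨a, ha, t, ht, rfl⟩ := hx
    obtain ⟨b, hb, u, hu, rfl⟩ := hy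
    obtain ⟨b', hb', t', ht', e⟩ := permutes_iff.1 h.symm t ht b hb
    refine ⟨a * b', mul_mem ha hb', t' * u, mul_mem ht' hu, ?_⟩
    rw [mul_assoc, ← mul_assoc b', ← e]; group
  | inv x _ hx =>
    obtain ⟨a, ha, t, ht, rfl⟩ := hx
    obtain ⟨a', ha', t', ht', e⟩ := permutes_iff.1 h.symm t⁻¹ (inv_mem ht) a⁻¹ (inv_mem ha)
    exact ⟨a', ha', t', ht', by rw [← e]; group⟩

/-- The natural injection of `A`-cosets into `A ⊔ T`-cosets is onto because every element of `A ⊔ T`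
is a product `a * t`. -/
theorem Permutes.relIndex_sup {A T : Subgroup G} (h : Permutes A T) :
    T.relIndex (A ⊔ T) = T.relIndex A := by
  refine (Nat.card_congr (Equiv.ofBijective
    (Subgroup.quotientSubgroupOfEmbeddingOfLE T (le_sup_left : A ≤ A ⊔ T))
    ⟨(Subgroup.quotientSubgroupOfEmbeddingOfLE T _).injective, fun q => ?_⟩)).symm
  induction q using QuotientGroup.induction_on with
  | H x =>
    obtain ⟨a, ha, t, ht, e⟩ := h.mem_sup x.2
    refine ⟨QuotientGroup.mk ⟨a, ha⟩, ?_⟩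
    rw [Subgroup.quotientSubgroupOfEmbeddingOfLE_apply_mk, QuotientGroup.eq]
    simpa [Subgroup.mem_subgroupOf, ← e] using ht

theorem Permutes.relIndex_sup' {A T : Subgroup G} (h : Permutes A T) :
    A.relIndex (A ⊔ T) = A.relIndex T := by
  rw [sup_comm]; exact h.symm.relIndex_sup

theorem Permutes.sup {A B T : Subgroup G} (hA : Permutes A T) (hB : Permutes B T) :
    Permutes (A ⊔ B) T := by
  have key : ∀ C : Subgroup G, Permutes C T → C ≤ A ⊔ B → ∀ c ∈ C, ∀ y : G,
      (∀ t ∈ T, ∃ t' ∈ T, ∃ j ∈ A ⊔ B, y * t = t' * j) →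
      ∀ t ∈ T, ∃ t' ∈ T, ∃ j ∈ A ⊔ B, c * y * t = t' * j := by
    intro C hC hle c hc y hy t ht
    obtain ⟨t', ht', j, hj, e⟩ := hy t ht
    obtain ⟨u, hu, c', hc', e'⟩ := permutes_iff.1 hC c hc t' ht'
    exact ⟨u, hu, c' * j, mul_mem (hle hc') hj, by rw [mul_assoc, e, ← mul_assoc, e', mul_assoc]⟩
  refine permutes_iff.2 fun x hx => ?_
  rw [Subgroup.sup_eq_closure] at hx
  induction hx using Subgroup.closure_induction_left with
  | one => exact fun t ht => ⟨t, ht, 1, one_mem _, by simp⟩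
  | mul_left x hx y _ hy =>
    rcases hx with hx | hx
    · exact key A hA le_sup_left x hx y hy
    · exact key B hB le_sup_right x hx y hy
  | inv_mul_cancel x hx y _ hy =>
    rcases hx with hx | hx
    · exact key A hA le_sup_left _ (inv_mem hx) y hy
    · exact key B hB le_sup_right _ (inv_mem hx) y hy

theorem mem_conjSubgroup {H : Subgroup G} {x y : G} :
    y ∈ conjSubgroup H x ↔ x * y * x⁻¹ ∈ H := by
  constructor
  · rintro ⟨h, hh, rfl⟩
    simpa [mul_assoc] using hh
  · intro h
    exact ⟨_, h, by simp [mul_assoc]⟩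

theorem conjSubgroup_conjSubgroup (H : Subgroup G) (x y : G) :
    conjSubgroup (conjSubgroup H x) y = conjSubgroup H (x * y) := by
  ext z; simp [mem_conjSubgroup, mul_assoc]

theorem conjSubgroup_one (H : Subgroup G) : conjSubgroup H 1 = H := by
  ext z; simp [mem_conjSubgroup]

theorem conjSubgroup_mono {H K : Subgroup G} (h : H ≤ K) (x : G) :
    conjSubgroup H x ≤ conjSubgroup K x := Subgroup.map_mono h

theorem card_conjSubgroup (H : Subgroup G) (x : G) :
    Nat.card (conjSubgroup H x) = Nat.card H :=
  (Nat.card_congr (H.equivMapOfInjective _ (MulAut.conj x⁻¹).injective).toEquiv).symm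

theorem index_conjSubgroup (H : Subgroup G) (x : G) : (conjSubgroup H x).index = H.index :=
  Subgroup.index_map_equiv H (MulAut.conj x⁻¹)

theorem Permutes.conj {A T : Subgroup G} (h : Permutes A T) (x : G) :
    Permutes (conjSubgroup A x) (conjSubgroup T x) := by
  refine permutes_iff.2 fun a ha t ht => ?_
  rw [mem_conjSubgroup] at ha ht
  obtain ⟨t', ht', a', ha', e⟩ := permutes_iff.1 h _ ha _ ht
  refine ⟨x⁻¹ * t' * x, ?_, x⁻¹ * a' * x, ?_, ?_⟩
  · rw [mem_conjSubgroup]; convert ht' using 1; group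
  · rw [mem_conjSubgroup]; convert ha' using 1; group
  · calc a * t = x⁻¹ * (x * a * x⁻¹ * (x * t * x⁻¹)) * x := by group
      _ = _ := by rw [e]; group

theorem IsHallPi.conj {π : Set Nat.Primes} {H : Subgroup G} (h : IsHallPi π H) (x : G) :
    IsHallPi π (conjSubgroup H x) := by
  rwa [IsHallPi, card_conjSubgroup, index_conjSubgroup]

/-! ### Groups of Sylow type -/

theorem IsHallPi.eq_of_le [Finite G] {π : Set Nat.Primes} {H K : Subgroup G} (h : IsHallPi π H)
    (hle : H ≤ K) (hK : IsPiNumber π (Nat.card K)) : H = K :=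
  hle.antisymm <| Subgroup.relIndex_eq_one.1 <|
    (hK.of_dvd (Subgroup.relIndex_dvd_card H K)).eq_one
      (h.2.of_dvd (Subgroup.relIndex_dvd_index_of_le hle))

theorem IsHallPi.map_equiv {π : Set Nat.Primes} {H : Subgroup G} (h : IsHallPi π H)
    (e : G ≃* G') : IsHallPi π (H.map (e : G →* G')) := by
  rw [IsHallPi, Subgroup.index_map_equiv,
    ← Nat.card_congr (H.equivMapOfInjective (e : G →* G') e.injective).toEquiv]
  exact h

theorem IsDGroup.of_equiv {π : Set Nat.Primes} (h : IsDGroup π G) (e : G ≃* G') :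
    IsDGroup π G' := by
  obtain ⟨E, hE, hB⟩ := h
  refine ⟨E.map (e : G →* G'), hE.map_equiv e, fun B hBπ => ?_⟩
  obtain ⟨x, hx⟩ := hB (B.map (e.symm : G' →* G)) (by
    rwa [← Nat.card_congr (B.equivMapOfInjective (e.symm : G' →* G) e.symm.injective).toEquiv])
  refine ⟨e x, fun b hb => ?_⟩
  have := mem_conjSubgroup.1 (hx (Subgroup.mem_map_of_mem _ hb))
  exact mem_conjSubgroup.2 ⟨_, this, by simp⟩

theorem IsSigmaFullOfSylowType.of_injective {σ : Set (Set Nat.Primes)}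
    (hG : IsSigmaFullOfSylowType σ G) (f : G' →* G) (hf : Function.Injective f) :
    IsSigmaFullOfSylowType σ G' := by
  intro E s hs
  have e := E.equivMapOfInjective f hf
  exact (hG (E.map f) s (by rwa [← Nat.card_congr e.toEquiv])).of_equiv e.symm

theorem IsSigmaFullOfSylowType.isDGroup {σ : Set (Set Nat.Primes)}
    (hG : IsSigmaFullOfSylowType σ G) {s : Set Nat.Primes} (hs : s ∈ σ) : IsDGroup s G := by
  by_cases h : s ∈ sigmaOf σ (Nat.card G)
  · exact (hG ⊤ s (by rwa [Subgroup.card_top])).of_equiv Subgroup.topEquiv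
  · have h' : IsPiNumber sᶜ (Nat.card G) := fun p hp hps => h ⟨hs, p, hps, hp⟩
    -- No prime of `s` divides the group order, so the trivial subgroup is the Hall `s`-subgroup.
    refine ⟨⊥, ⟨fun p hp => ?_, by rwa [Subgroup.index_bot]⟩, fun B hB => ⟨1, ?_⟩⟩
    · rw [Subgroup.card_bot] at hp
      exact absurd hp p.2.not_dvd_one
    · rw [conjSubgroup_one, Subgroup.eq_bot_of_card_eq B
        (hB.eq_one (h'.of_dvd (Subgroup.card_subgroup_dvd_card B)))]

theorem IsSigmaFullOfSylowType.exists_hall {σ : Set (Set Nat.Primes)}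
    (hG : IsSigmaFullOfSylowType σ G) {s : Set Nat.Primes} (hs : s ∈ σ) :
    ∃ T : Subgroup G, IsHallPi s T :=
  let ⟨E, hE, _⟩ := hG.isDGroup hs; ⟨E, hE⟩

theorem IsSigmaFullOfSylowType.exists_hall_ge {σ : Set (Set Nat.Primes)}
    (hG : IsSigmaFullOfSylowType σ G) {s : Set Nat.Primes} (hs : s ∈ σ) {B : Subgroup G}
    (hB : IsPiNumber s (Nat.card B)) : ∃ T : Subgroup G, IsHallPi s T ∧ B ≤ T := by
  obtain ⟨E, hE, h⟩ := hG.isDGroup hs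
  obtain ⟨x, hx⟩ := h B hB
  exact ⟨_, hE.conj x, hx⟩

theorem IsSigmaFullOfSylowType.exists_eq_conj [Finite G] {σ : Set (Set Nat.Primes)}
    (hG : IsSigmaFullOfSylowType σ G) {s : Set Nat.Primes} (hs : s ∈ σ) {S T : Subgroup G}
    (hS : IsHallPi s S) (hT : IsHallPi s T) : ∃ x : G, T = conjSubgroup S x := by
  obtain ⟨E, hE, h⟩ := hG.isDGroup hs
  obtain ⟨x, hx⟩ := h S hS.1
  obtain ⟨y, hy⟩ := h T hT.1
  have ex := hS.eq_of_le hx (hE.conj x).1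
  have ey := hT.eq_of_le hy (hE.conj y).1
  refine ⟨x⁻¹ * y, ?_⟩
  rw [ex, ey, conjSubgroup_conjSubgroup, mul_inv_cancel_left]

/-- `A` permutes with every Hall `s`-subgroup of `G`, for all `s ∈ σ`. -/
def PermutesWithHalls (σ : Set (Set Nat.Primes)) (A : Subgroup G) : Prop :=
  ∀ s ∈ σ, ∀ T : Subgroup G, IsHallPi s T → Permutes A T

theorem IsSigmaPermutable.permutesWithHalls [Finite G] {σ : Set (Set Nat.Primes)}
    (hG : IsSigmaFullOfSylowType σ G) {A : Subgroup G} (h : IsSigmaPermutable σ A) :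
    PermutesWithHalls σ A := by
  obtain ⟨ℋ, hℋ, hA⟩ := h
  intro s hs T hT
  by_cases hsG : s ∈ sigmaOf σ (Nat.card G)
  · obtain ⟨H, ⟨hH, hHs⟩, -⟩ := hℋ.2 s hsG
    obtain ⟨x, rfl⟩ := hG.exists_eq_conj hs hHs hT
    exact hA H hH x
  · have h' : IsPiNumber sᶜ (Nat.card G) := fun p hp hps => hsG ⟨hs, p, hps, hp⟩
    rw [Subgroup.eq_bot_of_card_eq T
        (hT.1.eq_one (h'.of_dvd (Subgroup.card_subgroup_dvd_card T)))]
    simp [Permutes]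

theorem PermutesWithHalls.isSigmaPermutable [Finite G] {σ : Set (Set Nat.Primes)}
    (hσ : Setoid.IsPartition σ) (hG : IsSigmaFullOfSylowType σ G) {A : Subgroup G}
    (h : PermutesWithHalls σ A) : IsSigmaPermutable σ A := by
  choose E hE using fun s : σ => hG.exists_hall s.2
  refine ⟨Set.range E, ⟨?_, fun s hs => ?_⟩, ?_⟩
  · rintro _ ⟨s, rfl⟩ -
    exact ⟨s, s.2, hE s⟩
  · refine ⟨E ⟨s, hs.1⟩, ⟨⟨_, rfl⟩, hE ⟨s, hs.1⟩⟩, ?_⟩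
    rintro _ ⟨⟨t, rfl⟩, ht⟩
    -- If `t ≠ s`, a prime of `s` dividing the group order could divide neither the order nor the
    -- index of `E t`.
    by_cases e : s = t
    · subst e; rfl
    · obtain ⟨hs, p, hp, hpG⟩ := hs
      rw [← (E t).card_mul_index] at hpG
      rcases p.2.dvd_mul.1 hpG with hd | hd
      · exact absurd ((hE t).1 p hd) (hσ.subset_compl hs t.2 e hp)
      · exact absurd hp (ht.2 p hd)
  · rintro _ ⟨s, rfl⟩ x
    exact h s s.2 _ ((hE s).conj x)

/-! ### Relative `σ`-subnormality -/

/-- `A` is a member of a `σ`-subnormal chain directly below `B`. -/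
def SigmaSubnormalStep (σ : Set (Set Nat.Primes)) (A B : Subgroup G) : Prop :=
  A ≤ B ∧ (Normalizes B A ∨
    ∃ N ≤ A, Normalizes B N ∧ ∃ s ∈ σ, IsPiNumber s (N.relIndex B))

/-- `A` is `σ`-subnormal in the subgroup `B`. -/
def SigmaSubnormalIn (σ : Set (Set Nat.Primes)) : Subgroup G → Subgroup G → Prop :=
  Relation.ReflTransGen (SigmaSubnormalStep σ)

theorem Normalizes.map {A B : Subgroup G} (h : Normalizes B A) (f : G →* G') :
    Normalizes (B.map f) (A.map f) := by
  rintro _ ⟨b, hb, rfl⟩ _ ⟨a, ha, rfl⟩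
  exact ⟨_, h b hb a ha, by simp⟩

theorem Normalizes.comap {A B : Subgroup G} (h : Normalizes B A) (f : G' →* G) :
    Normalizes (B.comap f) (A.comap f) := by
  intro b hb a ha
  simpa [Subgroup.mem_comap] using h _ hb _ ha

/-- With `I` the image of `B.comap f`, the left side is `|I : N ⊓ I| = |N I : N|`, where `N I ≤ B`
is a subgroup since `B` normalizes `N`. -/
theorem Subgroup.relIndex_comap_comap_dvd [Finite G] {N B : Subgroup G} (hNB : N ≤ B)
    (hB : Normalizes B N) (f : G' →* G) :
    (N.comap f).relIndex (B.comap f) ∣ N.relIndex B := by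
  rw [Subgroup.relIndex_comap]
  have hle : Subgroup.map f (B.comap f) ≤ B := Subgroup.map_comap_le f B
  have hp : Permutes N (Subgroup.map f (B.comap f)) :=
    Normalizes.permutes fun b hb => hB b (hle hb)
  rw [← hp.relIndex_sup', ← Subgroup.relIndex_mul_relIndex N _ B le_sup_left (sup_le hNB hle)]
  exact dvd_mul_right _ _

theorem SigmaSubnormalStep.map {σ : Set (Set Nat.Primes)} {A B : Subgroup G}
    (h : SigmaSubnormalStep σ A B) (f : G →* G') :
    SigmaSubnormalStep σ (A.map f) (B.map f) := by
  obtain ⟨hAB, h⟩ := h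
  refine ⟨Subgroup.map_mono hAB, ?_⟩
  rcases h with h | ⟨N, hN, hB, s, hs, hi⟩
  · exact Or.inl (h.map f)
  · refine Or.inr ⟨N.map f, Subgroup.map_mono hN, hB.map f, s, hs, hi.of_dvd ?_⟩
    rw [Subgroup.relIndex_map_map]
    have hp : Permutes (N ⊔ f.ker) B := (Normalizes.permutes hB).sup
      (Normalizes.permutes fun b _ a ha => (inferInstance : f.ker.Normal).conj_mem a ha b)
    have e : B ⊔ f.ker = N ⊔ f.ker ⊔ B := by
      rw [sup_right_comm, sup_eq_right.2 (hN.trans hAB)]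
    rw [e, hp.relIndex_sup']
    exact Subgroup.relIndex_dvd_of_le_left B le_sup_left

theorem SigmaSubnormalStep.comap [Finite G] {σ : Set (Set Nat.Primes)} {A B : Subgroup G}
    (h : SigmaSubnormalStep σ A B) (f : G' →* G) :
    SigmaSubnormalStep σ (A.comap f) (B.comap f) := by
  refine ⟨Subgroup.comap_mono h.1, ?_⟩
  rcases h.2 with h' | ⟨N, hN, hB, s, hs, hi⟩
  · exact Or.inl (h'.comap f)
  · exact Or.inr ⟨N.comap f, Subgroup.comap_mono hN, hB.comap f, s, hs,
      hi.of_dvd (Subgroup.relIndex_comap_comap_dvd (hN.trans h.1) hB f)⟩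

theorem SigmaSubnormalIn.map {σ : Set (Set Nat.Primes)} {A B : Subgroup G}
    (h : SigmaSubnormalIn σ A B) (f : G →* G') :
    SigmaSubnormalIn σ (A.map f) (B.map f) :=
  Relation.ReflTransGen.lift (p := SigmaSubnormalStep σ) (Subgroup.map f)
    (fun _ _ (h : SigmaSubnormalStep σ _ _) => h.map f) _ _ h

theorem SigmaSubnormalIn.comap [Finite G] {σ : Set (Set Nat.Primes)} {A B : Subgroup G}
    (h : SigmaSubnormalIn σ A B) (f : G' →* G) :
    SigmaSubnormalIn σ (A.comap f) (B.comap f) :=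
  Relation.ReflTransGen.lift (p := SigmaSubnormalStep σ) (Subgroup.comap f)
    (fun _ _ (h : SigmaSubnormalStep σ _ _) => h.comap f) _ _ h

theorem Relation.ReflTransGen.exists_chain {α : Type*} {r : α → α → Prop} {a b : α}
    (h : Relation.ReflTransGen r a b) :
    ∃ (t : ℕ) (c : ℕ → α), c 0 = a ∧ c t = b ∧ ∀ i < t, r (c i) (c (i + 1)) := by
  induction h using Relation.ReflTransGen.head_induction_on with
  | refl => exact ⟨0, fun _ => b, rfl, rfl, fun i hi => absurd hi (Nat.not_lt_zero i)⟩
  | @head a _ hac _ ih =>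
    obtain ⟨t, c, h0, ht, hc⟩ := ih
    refine ⟨t + 1, fun n => Nat.casesOn n a c, rfl, ht, fun i hi => ?_⟩
    cases i with
    | zero => simpa [h0] using hac
    | succ i => exact hc i (Nat.lt_of_succ_lt_succ hi)

theorem SigmaSubnormalIn.isSigmaSubnormal {σ : Set (Set Nat.Primes)}
    (hσ : Setoid.IsPartition σ) {A : Subgroup G} (h : SigmaSubnormalIn σ A ⊤) :
    IsSigmaSubnormal σ A := by
  obtain ⟨t, c, h0, ht, hc⟩ := Relation.ReflTransGen.exists_chain h
  refine ⟨t, c, h0, ht, fun i hi => ⟨(hc i hi).1, ?_⟩⟩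
  rcases (hc i hi).2 with hn | ⟨N, hN, hB, s, hs, hN'⟩
  · exact Or.inl ⟨fun a ha b => hn b b.2 a ha⟩
  · right
    have hle : N.subgroupOf (c (i + 1)) ≤ ((c i).subgroupOf (c (i + 1))).normalCore :=
      fun n hn b => hN (hB b b.2 n hn)
    have key : IsPiNumber s
        (Nat.card (c (i + 1) ⧸ ((c i).subgroupOf (c (i + 1))).normalCore)) :=
      hN'.of_dvd (Subgroup.index_dvd_of_le hle)
    have : ∀ t ∈ sigmaOf σ
        (Nat.card (c (i + 1) ⧸ ((c i).subgroupOf (c (i + 1))).normalCore)), t = s := by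
      rintro t ⟨ht, p, hp, hd⟩
      by_contra e
      exact hσ.subset_compl ht hs e hp (key p hd)
    exact fun t ht u hu => (this t ht).trans (this u hu).symm

/-! ### Hall subgroups and `σ`-subnormal subgroups -/

theorem Subgroup.sup_eq_of_isPiNumber_relIndex {π : Set Nat.Primes} {M N B : Subgroup G}
    (hM : M ≤ B) (hN : N ≤ B) (h : IsPiNumber π (M.relIndex B))
    (h' : IsPiNumber πᶜ (N.relIndex B)) : M ⊔ N = B :=
  (sup_le hM hN).antisymm <| Subgroup.relIndex_eq_one.1 <|
    (h.of_dvd (Subgroup.relIndex_dvd_of_le_left B le_sup_left)).eq_one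
      (h'.of_dvd (Subgroup.relIndex_dvd_of_le_left B le_sup_right))

theorem Permutes.relIndex_dvd {A T B : Subgroup G} (h : Permutes A T) (hA : A ≤ B) (hT : T ≤ B) :
    T.relIndex A ∣ T.relIndex B := by
  rw [← h.relIndex_sup, ← Subgroup.relIndex_mul_relIndex T _ B le_sup_right (sup_le hA hT)]
  exact dvd_mul_right _ _

/-- If `A` permutes with `K ⊓ B`, then `|A : A ⊓ K|` divides `|B : B ⊓ K|`. This covers a normal
step and also `s ⊆ ρ`, where coprime indices force `B = N (K ⊓ B)`. If `s ⊆ ρᶜ`, both factors of `|A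
: N| |N : N ⊓ K|` are `ρᶜ`-numbers. -/
theorem SigmaSubnormalStep.isPiNumber_relIndex {σ : Set (Set Nat.Primes)} {ρ : Set Nat.Primes}
    (hρ : ∀ s ∈ σ, s ⊆ ρ ∨ s ⊆ ρᶜ) {A B K : Subgroup G} (h : SigmaSubnormalStep σ A B)
    (hK : IsPiNumber ρᶜ (K.relIndex B)) : IsPiNumber ρᶜ (K.relIndex A) := by
  rw [← Subgroup.inf_relIndex_right] at hK
  have hA : (K ⊓ B).relIndex A = K.relIndex A := by
    rw [← Subgroup.inf_relIndex_right, inf_assoc, inf_eq_right.2 h.1,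
      Subgroup.inf_relIndex_right]
  rw [← hA]
  rcases h.2 with hn | ⟨N, hN, hB, s, hs, hNs⟩
  · exact hK.of_dvd (Permutes.relIndex_dvd (Normalizes.permutes fun b hb => hn b hb.2)
      h.1 inf_le_right)
  · have hNB := hN.trans h.1
    have hp : Permutes N (K ⊓ B) := Normalizes.permutes fun b hb => hB b hb.2
    rcases hρ s hs with hsρ | hsρ
    · have hsup := Subgroup.sup_eq_of_isPiNumber_relIndex hNB inf_le_right (hNs.mono hsρ) hK
      refine hK.of_dvd (Permutes.relIndex_dvd (permutes_iff.2 fun a ha t ht => ?_)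
        h.1 inf_le_right)
      have hx : a * t ∈ (K ⊓ B) ⊔ N := by
        rw [sup_comm, hsup]; exact mul_mem (h.1 ha) ht.2
      obtain ⟨t', ht', n, hn, e⟩ := hp.symm.mem_sup hx
      exact ⟨t', ht', n, hN hn, e.symm⟩
    · have h1 : IsPiNumber ρᶜ ((K ⊓ B).relIndex N) :=
        hK.of_dvd (hp.relIndex_dvd hNB inf_le_right)
      have h2 : IsPiNumber ρᶜ (N.relIndex A) :=
        (hNs.mono hsρ).of_dvd (Dvd.intro _ (Subgroup.relIndex_mul_relIndex N A B hN h.1))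
      refine IsPiNumber.of_dvd (h1.mul h2) ?_
      rw [← Subgroup.inf_relIndex_right _ N, Subgroup.relIndex_mul_relIndex _ N A inf_le_right hN]
      exact Subgroup.relIndex_dvd_of_le_left A inf_le_left

theorem SigmaSubnormalIn.isPiNumber_relIndex {σ : Set (Set Nat.Primes)} {ρ : Set Nat.Primes}
    (hρ : ∀ s ∈ σ, s ⊆ ρ ∨ s ⊆ ρᶜ) {A B K : Subgroup G} (h : SigmaSubnormalIn σ A B)
    (hK : IsPiNumber ρᶜ (K.relIndex B)) : IsPiNumber ρᶜ (K.relIndex A) := by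
  induction h using Relation.ReflTransGen.head_induction_on with
  | refl => exact hK
  | head h _ ih => exact h.isPiNumber_relIndex hρ ih

/-! ### Subgroups permuting with Hall subgroups are `σ`-subnormal -/

theorem Subgroup.le_of_forall_sylow [Finite G] {A M : Subgroup G}
    (h : ∀ p : Nat.Primes, ∀ P : Subgroup G, P ≤ M → IsPiNumber {p} (Nat.card P) → P ≤ A) :
    M ≤ A := by
  rw [← Subgroup.relIndex_eq_one]
  by_contra hne
  obtain ⟨p, hp, hd⟩ := Nat.exists_prime_and_dvd hne
  have : Fact p.Prime := ⟨hp⟩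
  obtain ⟨P⟩ : Nonempty (Sylow p M) := inferInstance
  have hcard : IsPiNumber {(⟨p, hp⟩ : Nat.Primes)} (Nat.card (P.map M.subtype)) := by
    rw [← Nat.card_congr ((P : Subgroup M).equivMapOfInjective _ M.subtype_injective).toEquiv]
    obtain ⟨n, hn⟩ := IsPGroup.iff_card.1 P.isPGroup'
    intro q hq
    rw [hn] at hq
    exact Subtype.ext ((Nat.prime_dvd_prime_iff_eq q.2 hp).1 (q.2.dvd_of_dvd_pow hq))
  have hle := h ⟨p, hp⟩ _ (Subgroup.map_subtype_le _) hcard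
  refine P.not_dvd_index (hd.trans (Subgroup.index_dvd_of_le ?_))
  exact fun x hx => hle ⟨x, hx, rfl⟩

theorem PermutesWithHalls.conj {σ : Set (Set Nat.Primes)} {A : Subgroup G}
    (h : PermutesWithHalls σ A) (x : G) : PermutesWithHalls σ (conjSubgroup A x) := by
  intro s hs T hT
  have := (h s hs _ (hT.conj x⁻¹)).conj x
  rwa [conjSubgroup_conjSubgroup, inv_mul_cancel, conjSubgroup_one] at this

/-- `|M : A|` is an `s`-number, and `A` contains every `t`-subgroup of `M` for `t ≠ s`. These
subgroups are closed under conjugation in `M`, so they lie in the core of `A`, whose index is then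
an `s`-number. -/
theorem PermutesWithHalls.step_of_le_sup [Finite G] {σ : Set (Set Nat.Primes)}
    (hσ : Setoid.IsPartition σ) (hG : IsSigmaFullOfSylowType σ G) {A M : Subgroup G}
    (hA : PermutesWithHalls σ A) (hAM : A ≤ M) {s : Set Nat.Primes} (hs : s ∈ σ) {T : Subgroup G}
    (hT : IsHallPi s T) (hM : M ≤ A ⊔ T) : SigmaSubnormalStep σ A M := by
  have hidx : ∀ t ∈ σ, ∀ S : Subgroup G, IsHallPi t S → IsPiNumber t (A.relIndex (A ⊔ S)) := by
    intro t ht S hS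
    rw [(hA t ht S hS).relIndex_sup']
    exact hS.1.of_dvd (Subgroup.relIndex_dvd_card A S)
  have hMs : IsPiNumber s (A.relIndex M) :=
    (hidx s hs T hT).of_dvd (Dvd.intro _ (Subgroup.relIndex_mul_relIndex A M _ hAM hM))
  -- Inside `M ⊓ (A ⊔ S)` the index of `A` is both an `s`-number and a `t`-number, hence 1.
  have hX : ∀ t ∈ σ, t ≠ s → ∀ X ≤ M, IsPiNumber t (Nat.card X) → X ≤ A := by
    intro t ht hts X hXM hX
    obtain ⟨S, hS, hXS⟩ := hG.exists_hall_ge ht hX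
    have h1 : A ≤ M ⊓ (A ⊔ S) := le_inf hAM le_sup_left
    have h2 : IsPiNumber s (A.relIndex (M ⊓ (A ⊔ S))) :=
      hMs.of_dvd (Dvd.intro _ (Subgroup.relIndex_mul_relIndex A _ M h1 inf_le_left))
    have h3 : IsPiNumber t (A.relIndex (M ⊓ (A ⊔ S))) :=
      (hidx t ht S hS).of_dvd (Dvd.intro _ (Subgroup.relIndex_mul_relIndex A _ _ h1 inf_le_right))
    exact (le_inf hXM (hXS.trans le_sup_right)).trans (Subgroup.relIndex_eq_one.1
      (h2.eq_one (h3.mono (hσ.subset_compl ht hs hts))))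
  refine ⟨hAM, Or.inr ⟨(A.subgroupOf M).normalCore.map M.subtype, ?_, ?_, s, hs, ?_⟩⟩
  · rintro _ ⟨x, hx, rfl⟩
    exact Subgroup.normalCore_le (A.subgroupOf M) hx
  · rintro b hb _ ⟨x, hx, rfl⟩
    exact ⟨⟨b, hb⟩ * x * ⟨b, hb⟩⁻¹, Subgroup.Normal.conj_mem inferInstance x hx _, rfl⟩
  · have e : ((A.subgroupOf M).normalCore.map M.subtype).relIndex M =
        (A.subgroupOf M).normalCore.index := by
      rw [Subgroup.relIndex, Subgroup.subgroupOf,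
        Subgroup.comap_map_eq_self_of_injective M.subtype_injective]
    rw [e]
    intro p hp
    by_contra hps
    obtain ⟨t, ⟨ht, hpt⟩, -⟩ := hσ.2 p
    have hts : t ≠ s := fun e => hps (e ▸ hpt)
    have : Fact (p : ℕ).Prime := ⟨p.2⟩
    obtain ⟨P⟩ : Nonempty (Sylow (p : ℕ) M) := inferInstance
    refine P.not_dvd_index (hp.trans (Subgroup.index_dvd_of_le fun x hx b => ?_))
    have hle := hX t ht hts ((conjSubgroup (P : Subgroup M) b⁻¹).map M.subtype)
      (Subgroup.map_subtype_le _) (by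
        rw [← Nat.card_congr
          ((conjSubgroup (P : Subgroup M) b⁻¹).equivMapOfInjective _ M.subtype_injective).toEquiv,
          card_conjSubgroup]
        obtain ⟨n, hn⟩ := IsPGroup.iff_card.1 P.isPGroup'
        intro q hq
        rw [hn] at hq
        exact Subtype.ext ((Nat.prime_dvd_prime_iff_eq q.2 p.2).1 (q.2.dvd_of_dvd_pow hq)) ▸ hpt)
    exact hle ⟨b * x * b⁻¹, mem_conjSubgroup.2 (by simpa [mul_assoc] using hx), rfl⟩

theorem Subgroup.card_lt_card_of_lt [Finite G] {H K : Subgroup G} (h : H < K) :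
    Nat.card H < Nat.card K :=
  lt_of_not_ge fun hge => h.ne (Subgroup.eq_of_le_of_card_ge h.le hge)

theorem PermutesWithHalls.sigmaSubnormalIn [Finite G] {σ : Set (Set Nat.Primes)}
    (hσ : Setoid.IsPartition σ) (hG : IsSigmaFullOfSylowType σ G) (A M : Subgroup G)
    (hA : PermutesWithHalls σ A) (hAM : A ≤ M) : SigmaSubnormalIn σ A M := by
  -- If some such `b` moves `A`, the join of `A` and its conjugate still permutes with all Hall
  -- subgroups and lies in `A ⊔ T`. It either equals `M`, giving one step, or splits the problem in
  -- two. If there is no such `b`, every subgroup of `M` of prime power order normalizes `A`, so `M`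
  -- does.
  by_cases h : ∃ s ∈ σ, ∃ T : Subgroup G, IsHallPi s T ∧ ∃ b ∈ T, b ∈ M ∧ ¬ conjSubgroup A b ≤ A
  · obtain ⟨s, hs, T, hT, b, hbT, hbM, hb⟩ := h
    have hJT : A ⊔ conjSubgroup A b ≤ A ⊔ T := by
      refine sup_le le_sup_left ?_
      rintro x hx
      have hbs : b ∈ A ⊔ T := le_sup_right (a := A) hbT
      have := mul_mem (mul_mem (inv_mem hbs) (le_sup_left (b := T) (mem_conjSubgroup.1 hx))) hbs
      simpa [mul_assoc] using this
    have hJM : A ⊔ conjSubgroup A b ≤ M := by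
      refine sup_le hAM fun x hx => ?_
      have := mul_mem (mul_mem (inv_mem hbM) (hAM (mem_conjSubgroup.1 hx))) hbM
      simpa [mul_assoc] using this
    have hlt : A < A ⊔ conjSubgroup A b := left_lt_sup.2 hb
    rcases hJM.eq_or_lt with e | hJlt
    · exact Relation.ReflTransGen.single (hA.step_of_le_sup hσ hG hAM hs hT (e ▸ hJT))
    · exact (PermutesWithHalls.sigmaSubnormalIn hσ hG A _ hA hlt.le).trans
        (PermutesWithHalls.sigmaSubnormalIn hσ hG _ M
          (fun t ht S hS => (hA t ht S hS).sup (hA.conj b t ht S hS)) hJM)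
  · push Not at h
    refine Relation.ReflTransGen.single ⟨hAM, Or.inl fun b hb a ha => ?_⟩
    have hle : M ≤ Subgroup.normalizer (A : Set G) := by
      refine Subgroup.le_of_forall_sylow fun p P hPM hP x hx => ?_
      obtain ⟨s, ⟨hs, hps⟩, -⟩ := hσ.2 p
      obtain ⟨T, hT, hPT⟩ := hG.exists_hall_ge hs (hP.mono (Set.singleton_subset_iff.2 hps))
      have hn : ∀ y ∈ P, ∀ a ∈ A, y * a * y⁻¹ ∈ A := fun y hy a ha =>
        h s hs T hT y⁻¹ (inv_mem (hPT hy)) (inv_mem (hPM hy))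
          (mem_conjSubgroup.2 (by simpa [mul_assoc] using ha))
      refine Subgroup.mem_normalizer_iff.2 fun a => ⟨hn x hx a, fun ha => ?_⟩
      simpa [mul_assoc] using hn x⁻¹ (inv_mem hx) _ ha
    exact (Subgroup.mem_normalizer_iff.1 (hle hb) a).1 ha
-- One recursive call shrinks `M`; the other keeps `M` and enlarges `A`.
termination_by (Nat.card M, Nat.card G - Nat.card A)
decreasing_by
  · exact Prod.Lex.left _ _ (Subgroup.card_lt_card_of_lt hJlt)
  · have := Subgroup.card_lt_card_of_lt hlt
    have := Subgroup.card_le_card_group (A ⊔ conjSubgroup A b)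
    exact Prod.Lex.right _ (by omega)

/-! ### `σ`-subnormal subgroups of `PσT`-groups -/

/-- In a non-normal step, a Hall `s`-subgroup supplements `N`, while for `t ≠ s` a Hall `t`-subgroup
lies in `N`, hence in `A`. -/
theorem SigmaSubnormalStep.permutesWithHalls {σ : Set (Set Nat.Primes)}
    (hσ : Setoid.IsPartition σ) {A : Subgroup G} (h : SigmaSubnormalStep σ A ⊤) :
    PermutesWithHalls σ A := by
  intro t ht T hT
  rcases h.2 with hn | ⟨N, hN, hB, s, hs, hNs⟩
  · exact Normalizes.permutes fun b _ => hn b (Subgroup.mem_top b)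
  · have hp : Permutes N T := Normalizes.permutes fun b _ => hB b (Subgroup.mem_top b)
    by_cases e : t = s
    · subst e
      have hsup : N ⊔ T = ⊤ := Subgroup.sup_eq_of_isPiNumber_relIndex le_top le_top hNs
        (by rw [Subgroup.relIndex_top_right]; exact hT.2)
      refine permutes_iff.2 fun a _ x _ => ?_
      have hx : a * x ∈ T ⊔ N := by rw [sup_comm, hsup]; exact Subgroup.mem_top _
      obtain ⟨t', ht', n, hn, e⟩ := hp.symm.mem_sup hx
      exact ⟨t', ht', n, hN hn, e.symm⟩
    · have h1 : IsPiNumber s (N.relIndex T) := hNs.of_dvd (hp.symm.relIndex_dvd le_top le_top)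
      have h2 : IsPiNumber sᶜ (N.relIndex T) :=
        (hT.1.of_dvd (Subgroup.relIndex_dvd_card N T)).mono (hσ.subset_compl ht hs e)
      have hTA := (Subgroup.relIndex_eq_one.1 (h1.eq_one h2)).trans hN
      exact Normalizes.permutes fun b hb a ha =>
        mul_mem (mul_mem (hTA hb) ha) (inv_mem (hTA hb))

/-- Descend the chain from `⊤`: each member is `σ`-permutable in the next by the one-step case, and
transitivity carries this to `G`. -/
theorem SigmaSubnormalIn.isSigmaPermutable [Finite G] {σ : Set (Set Nat.Primes)}
    (hσ : Setoid.IsPartition σ) (hG : IsSigmaFullOfSylowType σ G) (hT : IsPSigmaTGroup σ G)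
    {A : Subgroup G} (h : SigmaSubnormalIn σ A ⊤) : IsSigmaPermutable σ A := by
  induction h using Relation.ReflTransGen.head_induction_on with
  | refl =>
    exact PermutesWithHalls.isSigmaPermutable hσ hG fun s _ T _ =>
      Normalizes.permutes fun _ _ _ _ => Subgroup.mem_top _
  | @head A B hAB _ ih =>
    refine hT B A hAB.1 ?_ ih
    have hstep := hAB.comap B.subtype
    have e : B.comap B.subtype = ⊤ := Subgroup.subgroupOf_self B
    rw [e] at hstep
    exact (hstep.permutesWithHalls hσ).isSigmaPermutable hσ
      (hG.of_injective B.subtype B.subtype_injective)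

theorem IsSigmaPermutable.sigmaSubnormalIn_of_le [Finite G] {σ : Set (Set Nat.Primes)}
    (hσ : Setoid.IsPartition σ) (hG : IsSigmaFullOfSylowType σ G) {K H : Subgroup G}
    (hKH : K ≤ H) (hK : IsSigmaPermutable σ (K.subgroupOf H)) : SigmaSubnormalIn σ K H := by
  have hH := hG.of_injective H.subtype H.subtype_injective
  have := ((hK.permutesWithHalls hH).sigmaSubnormalIn hσ hH _ ⊤ le_top).map H.subtype
  rwa [Subgroup.map_subgroupOf_eq_of_le hKH, ← MonoidHom.range_eq_map,
    Subgroup.range_subtype] at this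

/-! ### Groups with a normal Hall subgroup -/

theorem IsHallPi.map_mk {π : Set Nat.Primes} {H : Subgroup G} (h : IsHallPi π H)
    (D : Subgroup G) [D.Normal] : IsHallPi π (H.map (QuotientGroup.mk' D)) :=
  ⟨h.1.of_dvd (Subgroup.card_map_dvd H _),
    h.2.of_dvd (Subgroup.index_map_dvd _ (QuotientGroup.mk'_surjective D))⟩

theorem IsHallPi.le_of_normal {π ρ : Set Nat.Primes} {D H : Subgroup G} [D.Normal]
    (hD : IsHallPi π D) (hH : IsPiNumber ρ (Nat.card H)) (hρ : ρ ⊆ π) : H ≤ D :=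
  Subgroup.relIndex_eq_one.1 <|
    ((hH.mono hρ).of_dvd (Subgroup.relIndex_dvd_card D H)).eq_one
      (hD.2.of_dvd (Subgroup.relIndex_dvd_index_of_normal D H))

theorem Subgroup.IsComplement'.conjSubgroup [Finite G] {D K : Subgroup G} [D.Normal]
    (h : D.IsComplement' K) (x : G) : D.IsComplement' (conjSubgroup K x) := by
  refine Subgroup.isComplement'_of_card_mul_and_disjoint ?_ (Subgroup.disjoint_def.2 ?_)
  · rw [card_conjSubgroup, h.card_mul_card]
  · intro y hyD hy
    have h1 := Subgroup.disjoint_def.1 h.disjoint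
      ((inferInstance : D.Normal).conj_mem y hyD x) (mem_conjSubgroup.1 hy)
    exact conj_eq_one_iff.1 h1

theorem Subgroup.IsComplement'.eq_of_mk_eq {D K : Subgroup G} [D.Normal]
    (h : D.IsComplement' K) {x y : G} (hx : x ∈ K) (hy : y ∈ K)
    (e : (QuotientGroup.mk' D) x = QuotientGroup.mk' D y) : x = y := by
  have h1 : x⁻¹ * y ∈ D := QuotientGroup.eq.1 e
  have h2 := Subgroup.disjoint_def.1 h.disjoint h1 (mul_mem (inv_mem hx) hy)
  exact inv_mul_eq_one.1 h2

theorem IsSigmaFullOfSylowType.quotient {σ : Set (Set Nat.Primes)}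
    (hG : IsSigmaFullOfSylowType σ G) {D K : Subgroup G} [D.Normal] (h : D.IsComplement' K) :
    IsSigmaFullOfSylowType σ (G ⧸ D) :=
  hG.of_injective (K.subtype.comp (h.symm.QuotientMulEquiv : G ⧸ D →* K))
    (K.subtype_injective.comp h.symm.QuotientMulEquiv.injective)

theorem Subgroup.IsComplement'.relIndex_isPiNumber {π : Set Nat.Primes} {D K : Subgroup G}
    (hD : IsHallPi π D) (h : D.IsComplement' K) : IsPiNumber π (K.relIndex ⊤) := by
  rw [Subgroup.relIndex_top_right, h.index_eq_card]
  exact hD.1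

section Complement

variable {σ : Set (Set Nat.Primes)} {π : Set Nat.Primes} {D K A : Subgroup G} [D.Normal]

/-- `A ⊓ D` and `A ⊓ K` have coprime indices in `A`. That `|A : A ⊓ K|` is a `π`-number is where
`σ`-subnormality enters. -/
theorem SigmaSubnormalIn.exists_mul_of_isComplement' (hπ : ∀ s ∈ σ, s ⊆ π ∨ s ⊆ πᶜ)
    (hD : IsHallPi π D) (hK : D.IsComplement' K) (hA : SigmaSubnormalIn σ A ⊤) {a : G}
    (ha : a ∈ A) : ∃ n ∈ A ⊓ D, ∃ k ∈ A ⊓ K, n * k = a := by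
  have hKA : IsPiNumber πᶜᶜ (K.relIndex A) := by
    refine hA.isPiNumber_relIndex (ρ := πᶜ) (fun s hs => ?_) ?_
    · rw [compl_compl]; exact (hπ s hs).symm
    · rw [compl_compl]; exact hK.relIndex_isPiNumber hD
  have hDA : IsPiNumber πᶜ (D.relIndex A) :=
    hD.2.of_dvd (Subgroup.relIndex_dvd_index_of_normal D A)
  rw [← Subgroup.inf_relIndex_left] at hKA hDA
  have hsup := Subgroup.sup_eq_of_isPiNumber_relIndex inf_le_left inf_le_left hDA hKA
  have hp : Permutes (A ⊓ D) (A ⊓ K) := Normalizes.permutes fun b hb a ha =>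
    Subgroup.mem_inf.2 ⟨mul_mem (mul_mem hb.1 ha.1) (inv_mem hb.1),
      (inferInstance : D.Normal).conj_mem a ha.2 b⟩
  exact hp.mem_sup (hsup.symm ▸ ha)

theorem SigmaSubnormalIn.mem_of_mk_mem (hπ : ∀ s ∈ σ, s ⊆ π ∨ s ⊆ πᶜ)
    (hD : IsHallPi π D) (hK : D.IsComplement' K) (hA : SigmaSubnormalIn σ A ⊤) {x : G}
    (hx : x ∈ K) (h : QuotientGroup.mk' D x ∈ A.map (QuotientGroup.mk' D)) : x ∈ A := by
  obtain ⟨a, ha, e⟩ := h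
  obtain ⟨n, hn, k, hk, rfl⟩ := hA.exists_mul_of_isComplement' hπ hD hK ha
  have hn1 : QuotientGroup.mk' D n = 1 := (QuotientGroup.eq_one_iff n).2 hn.2
  rw [map_mul, hn1, one_mul] at e
  rw [← hK.eq_of_mk_eq hk.2 hx e]
  exact hk.1

theorem SigmaSubnormalIn.normalizes [Finite G] (hπ : ∀ s ∈ σ, s ⊆ π ∨ s ⊆ πᶜ)
    (hD : IsHallPi π D) (hK : D.IsComplement' K) (hA : SigmaSubnormalIn σ A ⊤)
    (hN : (A ⊓ D).Normal) : Normalizes D A := by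
  intro d hd a ha
  obtain ⟨n, hn, k, hk, rfl⟩ := hA.exists_mul_of_isComplement' hπ hD hK ha
  have h1 : d * k * d⁻¹ ∈ A := by
    -- The element `d * k * d⁻¹` lies in another complement of `D` and has the same image as `k`
    -- modulo `D`.
    refine hA.mem_of_mk_mem hπ hD (hK.conjSubgroup d⁻¹)
      (mem_conjSubgroup.2 (by simpa [mul_assoc] using hk.2)) ⟨k, hk.1, ?_⟩
    have e : QuotientGroup.mk' D d = 1 := (QuotientGroup.eq_one_iff d).2 hd
    rw [map_mul, map_mul, map_inv, e, one_mul, inv_one, mul_one]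
  have h2 := mul_mem (hN.conj_mem n hn d).1 h1
  simpa [mul_assoc] using h2

/-- A Hall `s`-subgroup of a complement is one of `G`, since no prime of `s` divides `|D|`. It is
conjugate to `H`, and conjugates of complements are complements. -/
theorem IsSigmaFullOfSylowType.exists_isComplement'_ge [Finite G] (hG : IsSigmaFullOfSylowType σ G)
    (hD : IsHallPi π D) {s : Set Nat.Primes} (hs : s ∈ σ) (hsπ : s ⊆ πᶜ) {H : Subgroup G}
    (hH : IsHallPi s H) : ∃ K : Subgroup G, D.IsComplement' K ∧ H ≤ K := by
  obtain ⟨K, hK⟩ := Subgroup.exists_right_complement'_of_coprime (hD.1.coprime hD.2)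
  obtain ⟨E, hE⟩ := (hG.of_injective K.subtype K.subtype_injective).exists_hall hs
  have hE' : IsHallPi s (E.map K.subtype) := by
    refine ⟨?_, ?_⟩
    · rw [← Nat.card_congr (E.equivMapOfInjective _ K.subtype_injective).toEquiv]
      exact hE.1
    · rw [Subgroup.index_map_subtype]
      refine hE.2.mul (IsPiNumber.mono (π := π) ?_ (Set.subset_compl_comm.1 hsπ))
      rw [hK.index_eq_card]
      exact hD.1
  obtain ⟨x, rfl⟩ := hG.exists_eq_conj hs hE' hH
  exact ⟨_, hK.conjSubgroup x, conjSubgroup_mono (Subgroup.map_subtype_le E) x⟩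

theorem SigmaSubnormalIn.permutesWithHalls_of_map [Finite G] (hπ : ∀ s ∈ σ, s ⊆ π ∨ s ⊆ πᶜ)
    (hG : IsSigmaFullOfSylowType σ G) (hD : IsHallPi π D)
    (hA : SigmaSubnormalIn σ A ⊤) (hN : (A ⊓ D).Normal)
    (hq : PermutesWithHalls σ (A.map (QuotientGroup.mk' D))) : PermutesWithHalls σ A := by
  intro s hs H hH
  rcases hπ s hs with hsπ | hsπ
  · obtain ⟨K, hK⟩ := Subgroup.exists_right_complement'_of_coprime (hD.1.coprime hD.2)
    exact Normalizes.permutes fun h hh =>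
      hA.normalizes hπ hD hK hN h (hD.le_of_normal hH.1 hsπ hh)
  · obtain ⟨K, hK, hHK⟩ := hG.exists_isComplement'_ge hD hs hsπ hH
    refine permutes_iff.2 fun a ha h hh => ?_
    obtain ⟨n, hn, k, hk, rfl⟩ := hA.exists_mul_of_isComplement' hπ hD hK ha
    obtain ⟨_, ⟨h', hh', rfl⟩, b, hb, e⟩ := permutes_iff.1 (hq s hs _ (hH.map_mk D)) _
      (Subgroup.mem_map_of_mem _ hk.1) _ (Subgroup.mem_map_of_mem _ hh)
    -- All three factors lie in the complement `K`, so membership in `A` can be tested modulo `D`.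
    have hmem : h'⁻¹ * (k * h) ∈ A := by
      refine hA.mem_of_mk_mem hπ hD hK
        (mul_mem (inv_mem (hHK hh')) (mul_mem hk.2 (hHK hh))) ?_
      rw [map_mul, map_inv, map_mul, e, inv_mul_cancel_left]
      exact hb
    have hn' : h'⁻¹ * n * h' ∈ A := by simpa using (hN.conj_mem n hn h'⁻¹).1
    exact ⟨h', hh', _, mul_mem hn' hmem, by group⟩

end Complement

end

theorem theoremA {G : Type*} [Group G] [Finite G]
    (σ : Set (Set Nat.Primes)) (hσ : Setoid.IsPartition σ)
    (D : Subgroup G) [D.Normal] (hD : IsSigmaHall σ D)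
    (hquot : IsPSigmaTGroup σ (G ⧸ D))
    (hsub : ∀ K : Subgroup D, IsSigmaSubnormal σ K → (K.map D.subtype).Normal)
    (hG : IsSigmaFullOfSylowType σ G) :
    IsPSigmaTGroup σ G := by
  intro H K hKH hK hH
  obtain ⟨P, hP, hDP⟩ := hD
  have hDπ := hDP.isHallPi hσ hP
  have hKsub : SigmaSubnormalIn σ K ⊤ :=
    (hK.sigmaSubnormalIn_of_le hσ hG hKH).trans
      ((hH.permutesWithHalls hG).sigmaSubnormalIn hσ hG H ⊤ le_top)
  have hN : (K ⊓ D).Normal := by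
    have h := hsub _ ((hKsub.comap D.subtype).isSigmaSubnormal hσ)
    rwa [← Subgroup.subgroupOf, Subgroup.subgroupOf_map_subtype] at h
  obtain ⟨C, hC⟩ := Subgroup.exists_right_complement'_of_coprime (hDπ.1.coprime hDπ.2)
  have hQ := hG.quotient hC
  have hKq : SigmaSubnormalIn σ (K.map (QuotientGroup.mk' D)) ⊤ := by
    have h := hKsub.map (QuotientGroup.mk' D)
    rwa [Subgroup.map_top_of_surjective _ (QuotientGroup.mk'_surjective D)] at h
  exact (hKsub.permutesWithHalls_of_map (fun s hs => hσ.subset_or_subset_compl_sUnion hP hs) hG hDπ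
    hN ((hKq.isSigmaPermutable hσ hQ hquot).permutesWithHalls hQ)).isSigmaPermutable hσ hG
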